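/- Let $s=(s_n)_{n\ge 0}$ be a real sequence that is not identically zero. For $n\ge 0$ put $D_n=\det(s_{i+j})_{i,j=0}^{n}$, and let $\operatorname{rank}\mathcal H_\infty\in\{0,1,2,\dots\}\cup\{\infty\}$ be the rank of the infinite Hankel matrix $\mathcal H_\infty=(s_{i+j})_{i,j\ge 0}$, that is, the supremum over $n\ge 0$ of the ranks of the matrices $(s_{i+j})_{i,j=0}^{n}$. For $n\ge 1$ define the real polynomials $$P_n(x)=\begin{vmatrix} s_0&s_1&\cdots&s_n\\ s_1&s_2&\cdots&s_{n+1}\\ \vdots&\vdots&&\vdots\\ s_{n-1}&s_n&\cdots&s_{2n-1}\\ 1&x&\cdots&x^n\end{vmatrix},\qquad Q_n(x)=\begin{vmatrix} s_0&s_1&s_2&\cdots&s_n\\ s_1&s_2&s_3&\cdots&s_{n+1}\\ \vdots&\vdots&\vdots&&\vdots\\ s_{n-1}&s_n&s_{n+1}&\cdots&s_{2n-1}\\ 0&s_0&s_0x+s_1&\cdots&\sum_{k=0}^{n-1}s_kx^{n-1-k}\end{vmatrix}.$$ Below, $x$ ranges over a fixed field $\mathbb K$ which is either $\mathbb R$ or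 $\mathbb C$ (the result holds for both). 1. For every $m\ge 1$ with $D_{m-1}\ne 0$ there is a unique real sequence $s^{(m)}=(s^{(m)}_n)_{n\ge 0}$ such that $$\frac{Q_m(x)}{P_m(x)}=\sum_{k\ge 0}\frac{s^{(m)}_k}{x^{k+1}}\qquad\text{for all } |x|>\max\{|z| : z\in\mathbb C,\ P_m(z)=0\},$$ with absolute convergence, and $s^{(m)}_n=s_n$ for $0\le n\le 2m-1$. 2. Let $r\ge 1$ with $D_{r-1}\ne 0$. Then $P_r(x)=D_{r-1}x^r+\sum_{k=0}^{r-1}p_{r,k}x^k$ with real numbers $p_{r,k}$, and the following are equivalent: (a) $s=s^{(r)}$; (b) $D_n=0$ for all $n\ge r$; (c) $\displaystyle\sum_{k\ge 0}\frac{s_k}{x^{k+1}}=\frac{Q_r(x)}{P_r(x)}$, with absolute convergence, for all $|x|>\max\{|z| : z\in\mathbb C,\ P_r(z)=0\}$; (d) $D_{r-1}s_{r+m}+\sum_{k=0}^{r-1}p_{r,k}\,s_{k+m}=0$ for all $m\ge r$; (e) $\operatorname{rank}\mathcal H_\infty=r$. 3. If $r\ge 1$ and $\operatorname{rank}\mathcal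 H_\infty=r$, then $D_{r-1}\ne 0$. -/

import Mathlib

open Polynomial

noncomputable section

/-- The finite Hankel matrix `(s_{i+j})` with `0 ≤ i, j ≤ n`. -/
def hankelMatrix (s : ℕ → ℝ) (n : ℕ) : Matrix (Fin (n + 1)) (Fin (n + 1)) ℝ :=
  Matrix.of fun i j => s ((i : ℕ) + (j : ℕ))

/-- The Hankel determinant `D_n = det (s_{i+j})`, `0 ≤ i, j ≤ n`. -/
def hankelDet (s : ℕ → ℝ) (n : ℕ) : ℝ :=
  (hankelMatrix s n).det

/-- The rank of the infinite Hankel matrix `(s_{i+j})`, `i, j ≥ 0`: the supremum of the ranks of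
its finite upper left square blocks, an element of `{0, 1, 2, …} ∪ {∞}`. -/
def hankelRank (s : ℕ → ℝ) : ℕ∞ :=
  ⨆ n : ℕ, ((hankelMatrix s n).rank : ℕ∞)

/-- The Hankel determinant polynomial `P_n`: the determinant of order `n + 1` whose first `n` rows
are `(s_i, s_{i+1}, …, s_{i+n})`, `0 ≤ i < n`, and whose last row is `(1, x, …, x^n)`. -/
def hankelP (s : ℕ → ℝ) (n : ℕ) : ℝ[X] :=
  Matrix.det (Matrix.of fun i j : Fin (n + 1) =>
    if (i : ℕ) < n then C (s ((i : ℕ) + (j : ℕ))) else X ^ (j : ℕ))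

/-- The polynomial of the second kind `Q_n`: as `P_n`, with the last row replaced by
`(0, s_0, s_0 x + s_1, …, ∑_{k<n} s_k x^{n-1-k})`. -/
def hankelQ (s : ℕ → ℝ) (n : ℕ) : ℝ[X] :=
  Matrix.det (Matrix.of fun i j : Fin (n + 1) =>
    if (i : ℕ) < n then C (s ((i : ℕ) + (j : ℕ)))
    else ∑ k ∈ Finset.range (j : ℕ), C (s k) * X ^ ((j : ℕ) - 1 - k))

/-- The expansion `∑_{k ≥ 0} t_k / x^{k+1} = Q_m(x) / P_m(x)`, the series being (absolutely)
convergent, for all `x` in `𝕜` (the real or the complex numbers) whose absolute value exceeds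
that of every complex zero of `P_m`. -/
def HasExpansion (𝕜 : Type*) [RCLike 𝕜] (s : ℕ → ℝ) (m : ℕ) (t : ℕ → ℝ) : Prop :=
  ∀ x : 𝕜, (∀ z : ℂ, aeval z (hankelP s m) = 0 → ‖z‖ < ‖x‖) →
    HasSum (fun k : ℕ => (t k : 𝕜) / x ^ (k + 1))
      (aeval x (hankelQ s m) / aeval x (hankelP s m))

/-- The sequence `s^{(m)}` of the coefficients in the expansion of `Q_m / P_m`. -/
def approxSeq (𝕜 : Type*) [RCLike 𝕜] (s : ℕ → ℝ) (m : ℕ) : ℕ → ℝ :=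
  Classical.epsilon (HasExpansion 𝕜 s m)

end

/-! Sequences form an `ℝ[X]`-module through the shift `S`, and everything is read off from
annihilators. Expanding along the last row gives `(P_n(S) s)_i = 0` for `i < n`, and shows that
`Q_n` is the polynomial part of `P_n(x) ∑ s_k / x^{k+1}`. So if `P_m(S) t = 0` and `t` starts like
`s`, the series of `t` sums to `Q_m / P_m`; solving this recurrence from `s_0, …, s_{m-1}` produces
`s^{(m)}`. By uniqueness of expansions, (a), (c) and (d) all say `P_r(S) s = 0`.

For (b) and (e), a Hankel block is the map from polynomials `p` of bounded degree to initial entries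
of `p(S) s`. Division with remainder then controls ranks: an annihilator of degree `r` bounds every
rank by `r`, while `D_{r-1} ≠ 0` forces rank at least `r`. If all later determinants vanish,
dividing a kernel polynomial by `P_r` forces `P_r(S) s = 0`. -/

/-- The shift operator `(t_n) ↦ (t_{n+1})` on sequences. -/
def seqShift (R : Type*) [CommRing R] : Module.End R (ℕ → R) :=
  LinearMap.funLeft R R Nat.succ

/-- The action of a polynomial in the shift operator: `(p(S) t)_i = ∑ p_j t_{i+j}`. -/
noncomputable def shiftAct {R : Type*} [CommRing R] (p : R[X]) (t : ℕ → R) : ℕ → R :=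
  aeval (seqShift R) p t

/-! ### Polynomials acting through the shift -/

section Shift

variable {R : Type*} [CommRing R]

lemma seqShift_pow_apply (j : ℕ) (t : ℕ → R) (i : ℕ) : (seqShift R ^ j) t i = t (i + j) := by
  induction j generalizing i with
  | zero => simp
  | succ j ih =>
    rw [pow_succ', Module.End.mul_apply]
    change (seqShift R ^ j) t (i + 1) = _
    rw [ih]
    congr 1
    omega

lemma shiftAct_apply {p : R[X]} {N : ℕ} (hN : p.natDegree < N) (t : ℕ → R) (i : ℕ) :
    shiftAct p t i = ∑ j ∈ Finset.range N, p.coeff j * t (i + j) := by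
  rw [shiftAct, aeval_eq_sum_range' hN]
  simp [LinearMap.sum_apply, seqShift_pow_apply]

lemma shiftAct_mul (p q : R[X]) (t : ℕ → R) :
    shiftAct (p * q) t = shiftAct p (shiftAct q t) := by
  simp [shiftAct]

lemma shiftAct_add (p q : R[X]) (t : ℕ → R) :
    shiftAct (p + q) t = shiftAct p t + shiftAct q t := by
  simp [shiftAct]

@[simp]
lemma shiftAct_zero (t : ℕ → R) : shiftAct (0 : R[X]) t = 0 := by
  simp [shiftAct]

@[simp]
lemma shiftAct_zero_right (p : R[X]) : shiftAct p (0 : ℕ → R) = 0 := by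
  simp [shiftAct]

lemma shiftAct_X_sub_C (z : R) (t : ℕ → R) (i : ℕ) :
    shiftAct (X - C z) t i = t (i + 1) - z * t i := by
  simp [shiftAct, seqShift, LinearMap.funLeft]

lemma shiftAct_C (z : R) (t : ℕ → R) (i : ℕ) : shiftAct (C z) t i = z * t i := by
  simp [shiftAct]

end Shift

/-! ### Cofactors of the last row -/

section Laplace

/-- The cofactors of the last row in the determinants defining `hankelP` and `hankelQ`. -/
noncomputable def lastRowCofactor (s : ℕ → ℝ) (n : ℕ) (j : Fin (n + 1)) : ℝ :=
  (-1) ^ (n + (j : ℕ)) *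
    Matrix.det (Matrix.of fun a b : Fin n => s ((a : ℕ) + (j.succAbove b : ℕ)))

lemma det_lastRow_expand (s : ℕ → ℝ) (n : ℕ) (a : Fin (n + 1) → ℝ[X]) :
    Matrix.det (Matrix.of fun i j : Fin (n + 1) =>
      if (i : ℕ) < n then C (s ((i : ℕ) + (j : ℕ))) else a j)
      = ∑ j, C (lastRowCofactor s n j) * a j := by
  rw [Matrix.det_succ_row _ (Fin.last n)]
  refine Finset.sum_congr rfl fun j _ => ?_
  have : (Matrix.of fun i j : Fin (n + 1) =>
      if (i : ℕ) < n then C (s ((i : ℕ) + (j : ℕ))) else a j).submatrix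
        (Fin.last n).succAbove j.succAbove
      = (C : ℝ →+* ℝ[X]).mapMatrix
        (Matrix.of fun a b : Fin n => s ((a : ℕ) + (j.succAbove b : ℕ))) := by
    ext1 a b
    simp
  rw [this, ← RingHom.map_det]
  simp only [Fin.val_last, Matrix.of_apply, lt_self_iff_false, if_false, lastRowCofactor, C_mul,
    C_pow, C_neg, C_1]
  ring

/-- Putting row `i` in place of the last row repeats a row, so the determinant vanishes. -/
lemma sum_lastRowCofactor_eq_zero (s : ℕ → ℝ) {n i : ℕ} (hi : i < n) :
    ∑ j : Fin (n + 1), lastRowCofactor s n j * s (i + j) = 0 := by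
  have h := det_lastRow_expand s n fun j => C (s (i + (j : ℕ)))
  rw [Matrix.det_zero_of_row_eq (i := ⟨i, by omega⟩) (j := Fin.last n)] at h
  · simp_rw [← C_mul] at h
    rw [← map_sum, eq_comm, C_eq_zero] at h
    exact h
  · intro h
    simp [Fin.ext_iff] at h
    omega
  · ext1 j
    simp [hi]

lemma hankelP_eq_sum (s : ℕ → ℝ) (n : ℕ) :
    hankelP s n = ∑ j : Fin (n + 1), C (lastRowCofactor s n j) * X ^ (j : ℕ) :=
  det_lastRow_expand s n _

lemma hankelP_coeff (s : ℕ → ℝ) (n : ℕ) (j : Fin (n + 1)) :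
    (hankelP s n).coeff j = lastRowCofactor s n j := by
  rw [hankelP_eq_sum, finsetSum_coeff]
  simp only [coeff_C_mul, coeff_X_pow]
  rw [Finset.sum_eq_single j]
  · simp
  · intro b _ hb
    rw [if_neg (fun h => hb (Fin.ext h.symm)), mul_zero]
  · simp

lemma hankelP_natDegree_lt (s : ℕ → ℝ) (n : ℕ) : (hankelP s n).natDegree < n + 1 := by
  rw [hankelP_eq_sum]
  refine Nat.lt_succ_of_le (natDegree_sum_le_of_forall_le _ _ fun j _ => ?_)
  exact (natDegree_C_mul_X_pow_le _ _).trans (by omega)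

lemma hankelQ_eq_sum (s : ℕ → ℝ) (n : ℕ) :
    hankelQ s n = ∑ j ∈ Finset.range (n + 1), C ((hankelP s n).coeff j) *
      ∑ k ∈ Finset.range j, C (s k) * X ^ (j - 1 - k) := by
  rw [hankelQ, det_lastRow_expand, ← Fin.sum_univ_eq_sum_range
    (fun j => C ((hankelP s n).coeff j) * ∑ k ∈ Finset.range j, C (s k) * X ^ (j - 1 - k))]
  simp_rw [hankelP_coeff]

lemma hankelP_coeff_self (s : ℕ → ℝ) {n : ℕ} (hn : 1 ≤ n) :
    (hankelP s n).coeff n = hankelDet s (n - 1) := by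
  obtain ⟨n, rfl⟩ := Nat.exists_eq_add_of_le' hn
  have h := hankelP_coeff s (n + 1) (Fin.last _)
  rw [Fin.val_last] at h
  rw [h, lastRowCofactor, Fin.val_last, Even.neg_one_pow ⟨_, rfl⟩, one_mul, hankelDet]
  congr 1
  ext1 i j
  simp [hankelMatrix]

lemma hankelP_natDegree {s : ℕ → ℝ} {n : ℕ} (hn : 1 ≤ n) (h : hankelDet s (n - 1) ≠ 0) :
    (hankelP s n).natDegree = n :=
  le_antisymm (Nat.lt_succ_iff.mp (hankelP_natDegree_lt s n))
    (le_natDegree_of_ne_zero (by rwa [hankelP_coeff_self s hn]))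

lemma hankelP_ne_zero {s : ℕ → ℝ} {n : ℕ} (hn : 1 ≤ n) (h : hankelDet s (n - 1) ≠ 0) :
    hankelP s n ≠ 0 := by
  intro h0
  rw [← hankelP_coeff_self s hn, h0] at h
  simp at h

lemma shiftAct_hankelP_eq_zero (s : ℕ → ℝ) {n i : ℕ} (hi : i < n) :
    shiftAct (hankelP s n) s i = 0 := by
  rw [shiftAct_apply (hankelP_natDegree_lt s n),
    ← Fin.sum_univ_eq_sum_range (fun j => (hankelP s n).coeff j * s (i + j))]
  simp_rw [hankelP_coeff]
  exact sum_lastRowCofactor_eq_zero s hi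

lemma hankelP_eq_leading_add (s : ℕ → ℝ) {n : ℕ} (hn : 1 ≤ n) :
    hankelP s n = C (hankelDet s (n - 1)) * X ^ n
      + ∑ k ∈ Finset.range n, C ((hankelP s n).coeff k) * X ^ k := by
  conv_lhs => rw [as_sum_range_C_mul_X_pow' _ (hankelP_natDegree_lt s n), Finset.sum_range_succ,
    hankelP_coeff_self s hn, add_comm]

lemma shiftAct_hankelP_apply (s t : ℕ → ℝ) {n : ℕ} (hn : 1 ≤ n) (i : ℕ) :
    shiftAct (hankelP s n) t i = hankelDet s (n - 1) * t (n + i)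
      + ∑ k ∈ Finset.range n, (hankelP s n).coeff k * t (k + i) := by
  rw [shiftAct_apply (hankelP_natDegree_lt s n), Finset.sum_range_succ, hankelP_coeff_self s hn,
    add_comm]
  simp_rw [add_comm i]

end Laplace

/-! ### Convergence, uniqueness and existence of the expansion -/

section Expansion

/-- With `a`, `b` the two weighted sequences, `R a_{k+1} ≤ ‖z‖ a_k + b_k`. Summing bounds `(R - ‖z‖)
∑ a_k` by `R a_0 + ∑ b_k`. -/
lemma summable_div_pow_of_shiftAct_X_sub_C {R : ℝ} {z : ℂ} (hz : ‖z‖ < R) {t : ℕ → ℂ}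
    (h : Summable fun k => ‖shiftAct (X - C z) t k‖ / R ^ (k + 1)) :
    Summable fun k => ‖t k‖ / R ^ (k + 1) := by
  have hR : 0 < R := (norm_nonneg z).trans_lt hz
  set a : ℕ → ℝ := fun k => ‖t k‖ / R ^ (k + 1) with ha
  set b : ℕ → ℝ := fun k => ‖shiftAct (X - C z) t k‖ / R ^ (k + 1) with hb
  have ha0 : ∀ k, 0 ≤ a k := fun k => by positivity
  have hb0 : ∀ k, 0 ≤ b k := fun k => by positivity
  have hstep : ∀ k, R * a (k + 1) ≤ ‖z‖ * a k + b k := fun k => by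
    have h1 : ‖t (k + 1)‖ ≤ ‖z‖ * ‖t k‖ + ‖shiftAct (X - C z) t k‖ := by
      rw [shiftAct_X_sub_C, ← norm_mul]
      calc ‖t (k + 1)‖ = ‖z * t k + (t (k + 1) - z * t k)‖ := by congr 1; ring
        _ ≤ _ := norm_add_le _ _
    calc R * a (k + 1) = ‖t (k + 1)‖ / R ^ (k + 1) := by
          simp only [ha]; rw [pow_succ R (k + 1)]; field_simp
      _ ≤ (‖z‖ * ‖t k‖ + ‖shiftAct (X - C z) t k‖) / R ^ (k + 1) := by gcongr
      _ = _ := by simp only [ha, hb]; ring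
  refine summable_of_sum_range_le (c := (R * a 0 + ∑' k, b k) / (R - ‖z‖)) ha0 fun n => ?_
  rw [le_div_iff₀ (by linarith)]
  have hsum : R * ∑ k ∈ Finset.range n, a k ≤
      R * a 0 + (‖z‖ * ∑ k ∈ Finset.range n, a k + ∑ k ∈ Finset.range n, b k) := by
    calc R * ∑ k ∈ Finset.range n, a k ≤ R * ∑ k ∈ Finset.range (n + 1), a k := by
          gcongr
          exact n.le_succ
      _ = R * a 0 + ∑ k ∈ Finset.range n, R * a (k + 1) := by
          rw [Finset.sum_range_succ', mul_add, Finset.mul_sum, add_comm]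
      _ ≤ R * a 0 + ∑ k ∈ Finset.range n, (‖z‖ * a k + b k) := by
          gcongr with k _
          exact hstep k
      _ = _ := by rw [Finset.sum_add_distrib, Finset.mul_sum]
  have := h.sum_le_tsum (Finset.range n) fun i _ => hb0 i
  nlinarith

/-- Peeling off one complex root at a time reduces to a linear factor, so no closed form for
solutions of the recurrence is needed. -/
lemma summable_div_pow_of_shiftAct {R : ℝ} {p : ℂ[X]} (hp : p ≠ 0)
    (hroot : ∀ z, p.IsRoot z → ‖z‖ < R) {t : ℕ → ℂ}
    (h : Summable fun k => ‖shiftAct p t k‖ / R ^ (k + 1)) :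
    Summable fun k => ‖t k‖ / R ^ (k + 1) := by
  obtain ⟨n, hn⟩ : ∃ n, p.natDegree = n := ⟨_, rfl⟩
  induction n generalizing p t with
  | zero =>
    rw [natDegree_eq_zero] at hn
    obtain ⟨c, rfl⟩ := hn
    have hc : c ≠ 0 := by simpa using hp
    refine (h.mul_left ‖c‖⁻¹).congr fun k => ?_
    rw [shiftAct_C, norm_mul]
    field_simp
  | succ n ih =>
    obtain ⟨z, hz⟩ := IsAlgClosed.exists_root p
      (by rw [degree_eq_natDegree hp, hn]; exact_mod_cast Nat.succ_ne_zero n)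
    obtain ⟨q, rfl⟩ := dvd_iff_isRoot.mpr hz
    have hq : q ≠ 0 := right_ne_zero_of_mul hp
    rw [shiftAct_mul] at h
    refine ih hq (fun w hw => hroot w (by simp_all [IsRoot]))
      (summable_div_pow_of_shiftAct_X_sub_C (hroot z hz) h) ?_
    rw [natDegree_mul (X_sub_C_ne_zero z) hq, natDegree_X_sub_C] at hn
    omega

lemma summable_of_shiftAct_eq_zero {R : ℝ} {p : ℝ[X]} (hp : p ≠ 0)
    (hroot : ∀ z : ℂ, aeval z p = 0 → ‖z‖ < R) {t : ℕ → ℝ} (h : shiftAct p t = 0) :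
    Summable fun k => |t k| / R ^ (k + 1) := by
  have h0 : shiftAct (p.map (algebraMap ℝ ℂ)) (fun k => (t k : ℂ)) = 0 := by
    ext i
    have := congrFun h i
    rw [shiftAct_apply (Nat.lt_succ_self _)] at this
    rw [shiftAct_apply (N := p.natDegree + 1) (by rw [natDegree_map]; omega)]
    simp only [coeff_map, Complex.coe_algebraMap, Pi.zero_apply] at this ⊢
    exact_mod_cast this
  have := summable_div_pow_of_shiftAct (R := R) (p := p.map (algebraMap ℝ ℂ))
    (t := fun k => (t k : ℂ)) (by simpa using hp)
    (fun z hz => hroot z (by rwa [IsRoot, eval_map_algebraMap] at hz))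
    (by rw [h0]; simp)
  simpa using this

lemma exists_complex_root_norm_eq {𝕜 : Type*} [RCLike 𝕜] {p : ℝ[X]} {x : 𝕜}
    (h : aeval x p = 0) : ∃ z : ℂ, aeval z p = 0 ∧ ‖z‖ = ‖x‖ := by
  obtain hI | hI := RCLike.I_eq_zero_or_im_I_eq_one (K := 𝕜)
  · have hx : ((RCLike.re x : ℝ) : 𝕜) = x := by
      conv_rhs => rw [← RCLike.re_add_im x, hI, mul_zero, add_zero]
    refine ⟨(RCLike.re x : ℝ), ?_, ?_⟩
    · rw [← hx, ← RCLike.algebraMap_eq_ofReal, aeval_algebraMap_apply] at h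
      rw [← Complex.coe_algebraMap, aeval_algebraMap_apply]
      simpa using h
    · conv_rhs => rw [← hx]
      simp
  · refine ⟨RCLike.complexLinearIsometryEquiv hI x,
      ?_, (RCLike.complexLinearIsometryEquiv hI).norm_map x⟩
    have hpow : ∀ n : ℕ, RCLike.complexLinearIsometryEquiv hI (x ^ n)
        = RCLike.complexLinearIsometryEquiv hI x ^ n :=
      fun n => map_pow (RCLike.complexRingEquiv hI) x n
    have := congrArg (RCLike.complexLinearIsometryEquiv hI) h
    rw [aeval_eq_sum_range] at this ⊢
    simpa [hpow] using this

/-- Multiplication by `x^j` shifts the series and splits off a polynomial part; weighted by the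
coefficients of `P_m`, these parts add up to `Q_m`. -/
lemma hasSum_div_pow_shift {𝕜 : Type*} [RCLike 𝕜] {t : ℕ → ℝ} {x S : 𝕜} (hx : x ≠ 0)
    (h : HasSum (fun k : ℕ => (t k : 𝕜) / x ^ (k + 1)) S) (j : ℕ) :
    HasSum (fun i : ℕ => (t (i + j) : 𝕜) / x ^ (i + 1))
      (x ^ j * S - ∑ k ∈ Finset.range j, (t k : 𝕜) * x ^ (j - 1 - k)) := by
  have h1 := ((hasSum_nat_add_iff' j).mpr h).mul_left (x ^ j)
  convert h1 using 1
  · rfl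
  · funext i
    rw [show i + j + 1 = j + (i + 1) by ring, pow_add]
    field_simp
    ring
  · rw [mul_sub, Finset.mul_sum]
    congr 1
    refine Finset.sum_congr rfl fun k hk => ?_
    have hk := Finset.mem_range.mp hk
    have : x ^ j = x ^ (j - 1 - k) * x ^ (k + 1) := by
      rw [← pow_add]
      congr 1
      omega
    rw [this]
    field_simp

lemma hasExpansion_of_shiftAct_eq_zero (𝕜 : Type*) [RCLike 𝕜] {s t : ℕ → ℝ} {m : ℕ} (hm : 1 ≤ m)
    (hD : hankelDet s (m - 1) ≠ 0) (hst : ∀ n < m, t n = s n)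
    (ht : shiftAct (hankelP s m) t = 0) : HasExpansion 𝕜 s m t := by
  intro x hx
  have hP : aeval x (hankelP s m) ≠ 0 := fun h => by
    obtain ⟨z, hz, hzx⟩ := exists_complex_root_norm_eq h
    exact absurd hzx (hx z hz).ne
  -- As `m ≥ 1`, `P_m` has a complex root, and its norm is strictly below `‖x‖`.
  have hx0 : x ≠ 0 := by
    obtain ⟨z, hz⟩ := IsAlgClosed.exists_aeval_eq_zero ℂ (hankelP s m) (by
      rw [degree_eq_natDegree (hankelP_ne_zero hm hD), hankelP_natDegree hm hD]
      exact_mod_cast (by omega : m ≠ 0))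
    exact norm_pos_iff.mp ((norm_nonneg z).trans_lt (hx z hz))
  have hsum : Summable fun k : ℕ => (t k : 𝕜) / x ^ (k + 1) := by
    refine Summable.of_norm ?_
    simpa using summable_of_shiftAct_eq_zero (hankelP_ne_zero hm hD) hx ht
  obtain ⟨S, hS⟩ := hsum
  have key := hasSum_sum (s := Finset.range (m + 1)) fun j _ =>
    (hasSum_div_pow_shift hx0 hS j).mul_left (((hankelP s m).coeff j : ℝ) : 𝕜)
  have hzero : (fun i : ℕ => ∑ j ∈ Finset.range (m + 1),
      (((hankelP s m).coeff j : ℝ) : 𝕜) * ((t (i + j) : 𝕜) / x ^ (i + 1))) = fun _ => 0 := by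
    ext i
    have hi := congrFun ht i
    rw [shiftAct_apply (hankelP_natDegree_lt s m)] at hi
    simp_rw [← mul_div_assoc]
    rw [← Finset.sum_div]
    have : (∑ j ∈ Finset.range (m + 1), (((hankelP s m).coeff j : ℝ) : 𝕜) * (t (i + j) : 𝕜))
        = 0 := by
      exact_mod_cast congrArg (fun y : ℝ => (y : 𝕜)) hi
    rw [this, zero_div]
  rw [hzero] at key
  have h0 := key.unique hasSum_zero
  convert hS using 1
  rw [div_eq_iff hP, eq_comm, ← sub_eq_zero, ← h0, hankelQ_eq_sum,
    aeval_eq_sum_range' (hankelP_natDegree_lt s m)]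
  simp only [Algebra.smul_def, mul_sub, Finset.sum_sub_distrib, map_sum, map_mul, aeval_C, map_pow, aeval_X,
    RCLike.algebraMap_eq_ofReal]
  congr 1
  · rw [Finset.mul_sum]
    exact Finset.sum_congr rfl fun j _ => by ring
  · refine Finset.sum_congr rfl fun j hj => ?_
    congr 1
    refine Finset.sum_congr rfl fun k hk => ?_
    have := Finset.mem_range.mp hj
    have := Finset.mem_range.mp hk
    rw [hst k (by omega)]

/-- In `z = 1/x` the difference of the two series is a power series vanishing near `0`. -/
lemma HasExpansion.unique {𝕜 : Type*} [RCLike 𝕜] {s t u : ℕ → ℝ} {m : ℕ} (hP : hankelP s m ≠ 0)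
    (ht : HasExpansion 𝕜 s m t) (hu : HasExpansion 𝕜 s m u) : t = u := by
  have hfin : {z : ℂ | aeval z (hankelP s m) = 0}.Finite := by
    refine ((hankelP s m).rootSet_finite ℂ).subset fun z hz => ?_
    exact (mem_rootSet_of_ne hP).mpr hz
  obtain ⟨B, hB⟩ := (hfin.image norm).bddAbove
  -- The index moves by one because `1 / x^{k+1} = z^{k+1}`; the constant term is `0`.
  let c : ℕ → 𝕜 := fun n => Nat.casesOn n 0 fun k => ((t k - u k : ℝ) : 𝕜)
  have hser : HasFPowerSeriesAt (fun _ : 𝕜 => (0 : 𝕜))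
      (FormalMultilinearSeries.ofScalars 𝕜 c) 0 := by
    rw [hasFPowerSeriesAt_iff]
    have hev : ∀ᶠ z : 𝕜 in nhds 0, ‖z‖ * (|B| + 1) < 1 := by
      have : Filter.Tendsto (fun z : 𝕜 => ‖z‖ * (|B| + 1)) (nhds 0) (nhds 0) := by
        have : Continuous fun z : 𝕜 => ‖z‖ * (|B| + 1) := by fun_prop
        simpa using this.tendsto 0
      exact this.eventually_lt_const one_pos
    filter_upwards [hev] with z hz
    simp only [FormalMultilinearSeries.coeff_ofScalars, smul_eq_mul]
    rcases eq_or_ne z 0 with rfl | hz0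
    · convert hasSum_zero using 2 with n
      rcases n with _ | n <;> simp [c]
    · have hx : ∀ w : ℂ, aeval w (hankelP s m) = 0 → ‖w‖ < ‖z⁻¹‖ := fun w hw => by
        have h1 : ‖w‖ ≤ B := hB ⟨w, hw, rfl⟩
        have h2 : 0 < ‖z‖ := norm_pos_iff.mpr hz0
        rw [norm_inv, ← one_div, lt_div_iff₀ h2]
        nlinarith [le_abs_self B]
      have h := (ht _ hx).sub (hu _ hx)
      rw [sub_self] at h
      refine (hasSum_nat_add_iff' 1).mp ?_
      convert h using 1
      · ext k
        simp [c]
        ring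
      · simp [c]
  have hzero := hser.eq_zero
  ext k
  have hk : (FormalMultilinearSeries.ofScalars 𝕜 c).coeff (k + 1) = 0 := by
    rw [hzero]; rfl
  rw [FormalMultilinearSeries.coeff_ofScalars] at hk
  have : ((t k - u k : ℝ) : 𝕜) = 0 := hk
  exact sub_eq_zero.mp (by exact_mod_cast this)

lemma exists_shiftAct_hankelP_eq_zero {s : ℕ → ℝ} {m : ℕ} (hm : 1 ≤ m)
    (hD : hankelDet s (m - 1) ≠ 0) :
    ∃ t : ℕ → ℝ, (∀ n < 2 * m, t n = s n) ∧ shiftAct (hankelP s m) t = 0 := by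
  let E : LinearRecurrence ℝ :=
    ⟨m, fun k => -((hankelP s m).coeff k / hankelDet s (m - 1))⟩
  let t := E.mkSol fun n => s n
  have hsol : shiftAct (hankelP s m) t = 0 := by
    ext i
    have h : t (i + m) = ∑ k : Fin m, -((hankelP s m).coeff k / hankelDet s (m - 1)) * t (i + k) :=
      E.is_sol_mkSol _ i
    rw [Fin.sum_univ_eq_sum_range
      fun k => -((hankelP s m).coeff k / hankelDet s (m - 1)) * t (i + k)] at h
    rw [shiftAct_hankelP_apply s t hm, add_comm m i, h, Finset.mul_sum, ← Finset.sum_add_distrib]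
    refine Finset.sum_eq_zero fun k _ => ?_
    rw [add_comm k i]
    field_simp
    ring
  refine ⟨t, fun n => ?_, hsol⟩
  induction n using Nat.strong_induction_on with
  | _ n ih =>
    intro hn
    by_cases h : n < m
    · exact E.mkSol_eq_init _ ⟨n, h⟩
    -- For `i < m` both `s` and `t` satisfy the recurrence at `i`, so agreement extends from `m` to
    -- `2m` entries.
    · obtain ⟨i, rfl⟩ := Nat.exists_eq_add_of_le (not_lt.mp h)
      have h1 := congrFun hsol i
      have h2 := shiftAct_hankelP_eq_zero s (n := m) (i := i) (by omega)
      rw [Pi.zero_apply, ← h2, shiftAct_hankelP_apply _ _ hm, shiftAct_hankelP_apply _ _ hm,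
        Finset.sum_congr rfl fun k hk => by
          rw [ih (k + i) (by have := Finset.mem_range.mp hk; omega)
            (by have := Finset.mem_range.mp hk; omega)]] at h1
      exact mul_left_cancel₀ hD (add_right_cancel h1)

end Expansion

/-! ### Hankel determinants, ranks and annihilating polynomials -/

section Rank

/-- The first `M` entries of `p(S) s`, linearly in the polynomial `p`. -/
noncomputable def truncAct (s : ℕ → ℝ) (M : ℕ) : ℝ[X] →ₗ[ℝ] (Fin M → ℝ) where
  toFun p i := shiftAct p s i
  map_add' p q := by ext i; simp [shiftAct]
  map_smul' c p := by ext i; simp [shiftAct]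

lemma hankelMatrix_mulVec_coeff (s : ℕ → ℝ) {n : ℕ} {v : ℝ[X]} (hv : v ∈ degreeLT ℝ (n + 1)) :
    (hankelMatrix s n).mulVec (fun j => v.coeff j) = truncAct s (n + 1) v := by
  ext i
  have hdeg : v.natDegree < n + 1 := by
    rcases eq_or_ne v 0 with rfl | h0
    · simp
    · exact (natDegree_lt_iff_degree_lt h0).mpr (mem_degreeLT.mp hv)
  change _ = shiftAct v s i
  rw [shiftAct_apply hdeg, ← Fin.sum_univ_eq_sum_range (fun j => v.coeff j * s (i + j))]
  simp [Matrix.mulVec, dotProduct, hankelMatrix, mul_comm]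

lemma exists_coeff_eq {n : ℕ} (c : Fin n → ℝ) :
    ∃ v ∈ degreeLT ℝ n, (fun j : Fin n => v.coeff j) = c :=
  ⟨(degreeLTEquiv ℝ n).symm c, ((degreeLTEquiv ℝ n).symm c).2,
    (degreeLTEquiv ℝ n).apply_symm_apply c⟩

lemma eq_zero_of_coeff_eq_zero {n : ℕ} {v : ℝ[X]} (hv : v ∈ degreeLT ℝ n)
    (h : (fun j : Fin n => v.coeff j) = 0) : v = 0 := by
  have : (⟨v, hv⟩ : degreeLT ℝ n) = 0 := (degreeLTEquiv ℝ n).injective (by rw [map_zero]; exact h)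
  exact congrArg Subtype.val this

lemma eq_zero_of_hankelDet_ne_zero {s : ℕ → ℝ} {n : ℕ} (hD : hankelDet s n ≠ 0) {v : ℝ[X]}
    (hv : v ∈ degreeLT ℝ (n + 1)) (h0 : ∀ i ≤ n, shiftAct v s i = 0) : v = 0 := by
  refine eq_zero_of_coeff_eq_zero hv (Matrix.eq_zero_of_mulVec_eq_zero hD ?_)
  rw [hankelMatrix_mulVec_coeff s hv]
  ext i
  exact h0 i (by omega)

lemma exists_of_hankelDet_eq_zero {s : ℕ → ℝ} {n : ℕ} (hD : hankelDet s n = 0) :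
    ∃ v ∈ degreeLT ℝ (n + 1), v ≠ 0 ∧ ∀ i ≤ n, shiftAct v s i = 0 := by
  obtain ⟨c, hc, h⟩ := Matrix.exists_mulVec_eq_zero_iff.mpr hD
  obtain ⟨v, hv, rfl⟩ := exists_coeff_eq c
  refine ⟨v, hv, fun h0 => hc (by ext; simp [h0]), fun i hi => ?_⟩
  rw [hankelMatrix_mulVec_coeff s hv] at h
  exact congrFun h ⟨i, by omega⟩

lemma range_hankelMatrix_mulVecLin (s : ℕ → ℝ) (n : ℕ) :
    LinearMap.range (hankelMatrix s n).mulVecLin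
      = (degreeLT ℝ (n + 1)).map (truncAct s (n + 1)) := by
  ext y
  constructor
  · rintro ⟨c, rfl⟩
    obtain ⟨v, hv, rfl⟩ := exists_coeff_eq c
    exact ⟨v, hv, (hankelMatrix_mulVec_coeff s hv).symm⟩
  · rintro ⟨v, hv, rfl⟩
    exact ⟨_, hankelMatrix_mulVec_coeff s hv⟩

lemma finrank_degreeLT (n : ℕ) : Module.finrank ℝ (degreeLT ℝ n) = n := by
  rw [(degreeLTEquiv ℝ n).finrank_eq, Module.finrank_fin_fun]

lemma shiftAct_mod {s : ℕ → ℝ} {g : ℝ[X]} (hg : shiftAct g s = 0) (v : ℝ[X]) :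
    shiftAct (v % g) s = shiftAct v s := by
  conv_rhs => rw [← EuclideanDomain.mod_add_div v g, mul_comm, shiftAct_add, shiftAct_mul, hg,
    shiftAct_zero_right, add_zero]

lemma mod_mem_degreeLT {g : ℝ[X]} (hg : g ≠ 0) (v : ℝ[X]) : v % g ∈ degreeLT ℝ g.natDegree := by
  rw [mem_degreeLT, ← degree_eq_natDegree hg]
  exact EuclideanDomain.mod_lt v hg

/-- Modulo `g` every polynomial acts on `s` as one of degree below `g.natDegree`. -/
lemma hankelMatrix_rank_le_natDegree {s : ℕ → ℝ} {g : ℝ[X]} (hg : g ≠ 0)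
    (h : shiftAct g s = 0) (n : ℕ) : (hankelMatrix s n).rank ≤ g.natDegree := by
  have : Module.Finite ℝ (degreeLT ℝ g.natDegree) := .equiv (degreeLTEquiv ℝ g.natDegree).symm
  rw [Matrix.rank, range_hankelMatrix_mulVecLin]
  refine (Submodule.finrank_mono (t := (degreeLT ℝ g.natDegree).map (truncAct s (n + 1))) ?_).trans
    ((Submodule.finrank_map_le _ _).trans (finrank_degreeLT _).le)
  rintro _ ⟨v, -, rfl⟩
  refine ⟨v % g, mod_mem_degreeLT hg v, ?_⟩
  ext i
  exact congrFun (shiftAct_mod h v) i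

lemma hankelRank_le_natDegree {s : ℕ → ℝ} {g : ℝ[X]} (hg : g ≠ 0) (h : shiftAct g s = 0) :
    hankelRank s ≤ g.natDegree :=
  iSup_le fun n => by exact_mod_cast hankelMatrix_rank_le_natDegree hg h n

lemma le_hankelRank_of_hankelDet_ne_zero {s : ℕ → ℝ} {n : ℕ} (h : hankelDet s n ≠ 0) :
    ((n + 1 : ℕ) : ℕ∞) ≤ hankelRank s := by
  refine le_trans ?_ (le_iSup (fun n : ℕ => ((hankelMatrix s n).rank : ℕ∞)) n)
  rw [Matrix.rank_of_isUnit _ ((Matrix.isUnit_iff_isUnit_det _).mpr (Ne.isUnit h)),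
    Fintype.card_fin]

/-- Let `M` be the first index with `(P(S) s)_M ≠ 0`. Since `D_M = 0`, some `v = w + P q ≠ 0` of
degree at most `M` kills the entries up to `M`. Entries below `r` force `w = 0`; entry `M - deg q`
then equals the leading coefficient of `q` times `(P(S) s)_M`, a contradiction. -/
lemma shiftAct_hankelP_eq_zero_of_hankelDet_eq_zero {s : ℕ → ℝ} {r : ℕ} (hr : 1 ≤ r)
    (hD : hankelDet s (r - 1) ≠ 0) (h : ∀ n, r ≤ n → hankelDet s n = 0) :
    shiftAct (hankelP s r) s = 0 := by
  set P := hankelP s r with hPdef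
  have hP0 : P ≠ 0 := hankelP_ne_zero hr hD
  have hPdeg : P.natDegree = r := hankelP_natDegree hr hD
  ext M
  induction M using Nat.strong_induction_on with
  | _ M ih =>
  by_contra hM
  rw [Pi.zero_apply] at hM
  have hrM : r ≤ M := not_lt.mp fun hlt => hM (shiftAct_hankelP_eq_zero s hlt)
  obtain ⟨v, hv, hv0, hvs⟩ := exists_of_hankelDet_eq_zero (h M hrM)
  have hdecomp := EuclideanDomain.mod_add_div v P
  set w := v % P
  set q := v / P
  have hwdeg : w ∈ degreeLT ℝ (r - 1 + 1) := by
    have := mod_mem_degreeLT hP0 v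
    rwa [hPdeg, ← Nat.sub_add_cancel hr] at this
  have hvdeg : v.natDegree ≤ M :=
    Nat.lt_succ_iff.mp ((natDegree_lt_iff_degree_lt hv0).mpr (mem_degreeLT.mp hv))
  have hqdeg : q.natDegree + r ≤ M ∨ q = 0 := by
    by_cases hq : q = 0
    · exact Or.inr hq
    · left
      have h1 : (P * q).natDegree ≤ M := by
        rw [eq_sub_of_add_eq' hdecomp]
        refine (natDegree_sub_le _ _).trans (max_le hvdeg ?_)
        rcases eq_or_ne w 0 with h0 | h0
        · simp [h0]
        · have := (natDegree_lt_iff_degree_lt h0).mpr (mem_degreeLT.mp hwdeg)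
          omega
      rw [natDegree_mul hP0 hq, hPdeg] at h1
      omega
  have hact : ∀ i, shiftAct v s i = shiftAct w s i
      + ∑ j ∈ Finset.range (q.natDegree + 1), q.coeff j * shiftAct P s (i + j) := fun i => by
    rw [← hdecomp, shiftAct_add, mul_comm, shiftAct_mul, Pi.add_apply,
      shiftAct_apply (Nat.lt_succ_self q.natDegree)]
  have hw0 : w = 0 := by
    refine eq_zero_of_hankelDet_ne_zero hD hwdeg fun i hi => ?_
    have h1 := hact i
    rw [hvs i (by omega), Finset.sum_eq_zero, add_zero] at h1
    · exact h1.symm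
    · intro j hj
      rcases hqdeg with hq | hq
      · have := Finset.mem_range.mp hj
        rw [ih (i + j) (by omega), Pi.zero_apply, mul_zero]
      · simp [hq]
  have hq0 : q ≠ 0 := fun hq => hv0 (by rw [← hdecomp, hw0, hq]; simp)
  replace hqdeg := hqdeg.resolve_right hq0
  have h2 := hact (M - q.natDegree)
  rw [hvs _ (by omega), hw0, shiftAct_zero, Pi.zero_apply, zero_add, Finset.sum_range_succ,
    Finset.sum_eq_zero, zero_add, Nat.sub_add_cancel (by omega)] at h2
  · exact mul_ne_zero (leadingCoeff_ne_zero.mpr hq0) hM h2.symm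
  · intro j hj
    have := Finset.mem_range.mp hj
    rw [ih _ (by omega), Pi.zero_apply, mul_zero]

/-- The kernels on an `(r+1)`-dimensional space decrease and hence stabilize, and a rank at most `r`
keeps the stable one nonzero. -/
lemma exists_shiftAct_eq_zero_of_rank_le {s : ℕ → ℝ} {r : ℕ}
    (h : ∀ n, (hankelMatrix s n).rank ≤ r) :
    ∃ v ∈ degreeLT ℝ (r + 1), v ≠ 0 ∧ shiftAct v s = 0 := by
  have : Module.Finite ℝ (degreeLT ℝ (r + 1)) := .equiv (degreeLTEquiv ℝ (r + 1)).symm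
  let T : (n : ℕ) → degreeLT ℝ (r + 1) →ₗ[ℝ] (Fin (n + 1) → ℝ) :=
    fun n => (truncAct s (n + 1)).domRestrict (degreeLT ℝ (r + 1))
  have hanti : Antitone fun n => LinearMap.ker (T n) := fun m n hmn v hv => by
    rw [LinearMap.mem_ker] at hv ⊢
    ext i
    exact congrFun hv ⟨i, by omega⟩
  obtain ⟨N, hN⟩ := IsArtinian.monotone_stabilizes
    (R := ℝ) (M := degreeLT ℝ (r + 1)) ⟨fun n => OrderDual.toDual (LinearMap.ker (T n)), hanti⟩
  -- The block must have size at least `r + 1` to accept all polynomials of degree at most `r`.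
  have hker : LinearMap.ker (T (max N r)) ≠ ⊥ := fun hbot => by
    have h1 := LinearMap.finrank_range_of_inj (LinearMap.ker_eq_bot.mp hbot)
    have h2 : LinearMap.range (T (max N r))
        ≤ LinearMap.range (hankelMatrix s (max N r)).mulVecLin := by
      rw [range_hankelMatrix_mulVecLin]
      rintro _ ⟨v, rfl⟩
      exact ⟨v, degreeLT_mono (by omega) v.2, rfl⟩
    have h3 := Submodule.finrank_mono h2
    rw [h1, finrank_degreeLT] at h3
    have h4 := h (max N r)
    rw [Matrix.rank] at h4
    omega
  obtain ⟨v, hv, hv0⟩ := Submodule.exists_mem_ne_zero_of_ne_bot hker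
  refine ⟨v, v.2, fun h0 => hv0 (Subtype.ext h0), ?_⟩
  ext i
  have hle : ∀ m, N ≤ m → LinearMap.ker (T N) = LinearMap.ker (T m) := hN
  rw [← hle _ (le_max_left _ _), hle (max N i) (le_max_left _ _), LinearMap.mem_ker] at hv
  exact congrFun hv ⟨i, by omega⟩

/-- Otherwise some `w ≠ 0` of degree below `r` kills the first `r` entries. An annihilator `g` of
degree at most `r` reduces every other entry to these, so `w(S) s = 0` and the rank drops below `r`.
-/
lemma hankelDet_ne_zero_of_hankelRank_eq {s : ℕ → ℝ} {r : ℕ} (hr : 1 ≤ r)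
    (h : hankelRank s = r) : hankelDet s (r - 1) ≠ 0 := by
  intro hD
  obtain ⟨w, hw, hw0, hws⟩ := exists_of_hankelDet_eq_zero hD
  rw [Nat.sub_add_cancel hr] at hw
  obtain ⟨g, hg, hg0, hgs⟩ := exists_shiftAct_eq_zero_of_rank_le (s := s) (r := r) fun n => by
    have := le_iSup (fun n : ℕ => ((hankelMatrix s n).rank : ℕ∞)) n
    exact_mod_cast this.trans h.le
  have hgdeg : g.natDegree ≤ r :=
    Nat.lt_succ_iff.mp ((natDegree_lt_iff_degree_lt hg0).mpr (mem_degreeLT.mp hg))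
  have hws' : shiftAct w s = 0 := by
    ext i
    have h1 : shiftAct w s i = shiftAct w (shiftAct (X ^ i) s) 0 := by
      rw [← shiftAct_mul, mul_comm, shiftAct_mul]
      simp [shiftAct, seqShift_pow_apply]
    rw [h1, ← shiftAct_mod hgs, ← shiftAct_mul, mul_comm, shiftAct_mul]
    have h2 := mod_mem_degreeLT hg0 (X ^ i)
    have h3 : (X ^ i % g).natDegree < r ∨ X ^ i % g = 0 := by
      rcases eq_or_ne (X ^ i % g) 0 with h0 | h0
      · exact Or.inr h0
      · exact Or.inl (((natDegree_lt_iff_degree_lt h0).mpr (mem_degreeLT.mp h2)).trans_le hgdeg)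
    rcases h3 with h3 | h3
    · rw [shiftAct_apply h3]
      refine Finset.sum_eq_zero fun j hj => ?_
      have := Finset.mem_range.mp hj
      rw [hws _ (by omega), mul_zero]
    · simp [h3]
  have h4 := hankelRank_le_natDegree hw0 hws'
  have h5 := (natDegree_lt_iff_degree_lt hw0).mpr (mem_degreeLT.mp hw)
  rw [h] at h4
  exact absurd h5 (not_lt.mpr (by exact_mod_cast h4))

end Rank

theorem corollary1 (𝕜 : Type*) [RCLike 𝕜] (s : ℕ → ℝ) (hs : ∃ n, s n ≠ 0) :
    -- `s^{(m)}` is well defined by its expansion, and starts with `s_0, …, s_{2m-1}`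
    (∀ m : ℕ, 1 ≤ m → hankelDet s (m - 1) ≠ 0 →
      HasExpansion 𝕜 s m (approxSeq 𝕜 s m) ∧
      (∀ t : ℕ → ℝ, HasExpansion 𝕜 s m t → t = approxSeq 𝕜 s m) ∧
      (∀ n : ℕ, n ≤ 2 * m - 1 → approxSeq 𝕜 s m n = s n)) ∧
    -- the equivalent conditions
    (∀ r : ℕ, 1 ≤ r → hankelDet s (r - 1) ≠ 0 →
      hankelP s r = C (hankelDet s (r - 1)) * X ^ r
        + ∑ k ∈ Finset.range r, C ((hankelP s r).coeff k) * X ^ k ∧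
      List.TFAE [
        s = approxSeq 𝕜 s r,
        ∀ n : ℕ, r ≤ n → hankelDet s n = 0,
        HasExpansion 𝕜 s r s,
        ∀ m : ℕ, r ≤ m → hankelDet s (r - 1) * s (r + m)
          + ∑ k ∈ Finset.range r, (hankelP s r).coeff k * s (k + m) = 0,
        hankelRank s = (r : ℕ∞)]) ∧
    -- the rank determines a nonzero Hankel determinant
    (∀ r : ℕ, 1 ≤ r → hankelRank s = (r : ℕ∞) → hankelDet s (r - 1) ≠ 0) := by
  have hexp : ∀ m : ℕ, 1 ≤ m → hankelDet s (m - 1) ≠ 0 →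
      HasExpansion 𝕜 s m (approxSeq 𝕜 s m) ∧ (∀ n < 2 * m, approxSeq 𝕜 s m n = s n) ∧
        shiftAct (hankelP s m) (approxSeq 𝕜 s m) = 0 := fun m hm hD => by
    obtain ⟨t, hts, ht⟩ := exists_shiftAct_hankelP_eq_zero hm hD
    have htE : HasExpansion 𝕜 s m t :=
      hasExpansion_of_shiftAct_eq_zero 𝕜 hm hD (fun n hn => hts n (by omega)) ht
    have hE : HasExpansion 𝕜 s m (approxSeq 𝕜 s m) := Classical.epsilon_spec ⟨t, htE⟩
    have : approxSeq 𝕜 s m = t := hE.unique (hankelP_ne_zero hm hD) htE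
    exact ⟨hE, this ▸ hts, this ▸ ht⟩
  refine ⟨fun m hm hD => ?_, fun r hr hD => ⟨hankelP_eq_leading_add s hr, ?_⟩,
    fun r hr h => hankelDet_ne_zero_of_hankelRank_eq hr h⟩
  · obtain ⟨h1, h2, -⟩ := hexp m hm hD
    exact ⟨h1, fun t ht => ht.unique (hankelP_ne_zero hm hD) h1, fun n hn => h2 n (by omega)⟩
  · obtain ⟨h1, -, h3⟩ := hexp r hr hD
    have hrec : (∀ m : ℕ, r ≤ m → hankelDet s (r - 1) * s (r + m)
        + ∑ k ∈ Finset.range r, (hankelP s r).coeff k * s (k + m) = 0) ↔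
        shiftAct (hankelP s r) s = 0 := by
      simp_rw [← shiftAct_hankelP_apply s s hr]
      refine ⟨fun h => ?_, fun h m _ => congrFun h m⟩
      ext i
      -- Below `r` the recurrence is automatic, which is why (d) only asks for `m ≥ r`.
      rcases lt_or_ge i r with hi | hi
      · exact shiftAct_hankelP_eq_zero s hi
      · exact h i hi
    rw [hrec]
    tfae_have 1 → 3 := fun h => by
      rw [← h] at h1
      exact h1
    tfae_have 3 → 1 := fun h => h.unique (hankelP_ne_zero hr hD) h1
    tfae_have 1 → 4 := fun h => by
      rw [← h] at h3
      exact h3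
    tfae_have 4 → 3 := fun h =>
      hasExpansion_of_shiftAct_eq_zero 𝕜 hr hD (fun _ _ => rfl) h
    tfae_have 2 → 4 := shiftAct_hankelP_eq_zero_of_hankelDet_eq_zero hr hD
    tfae_have 4 → 5 := fun h => by
      refine le_antisymm ?_ ?_
      · have := hankelRank_le_natDegree (hankelP_ne_zero hr hD) h
        rwa [hankelP_natDegree hr hD] at this
      · have := le_hankelRank_of_hankelDet_ne_zero hD
        rwa [Nat.sub_add_cancel hr] at this
    tfae_have 5 → 2 := fun h n hn => by
      by_contra hne
      have := le_hankelRank_of_hankelDet_ne_zero hne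
      rw [h] at this
      have : n + 1 ≤ r := by exact_mod_cast this
      omega
    tfae_finish
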